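/- All spaces are Tychonoff. For a space $X$ let $F(X)$ and $A(X)$ denote the (Markov) free topological group and the free Abelian topological group over $X$, i.e. the free group, respectively the free Abelian group, on the set $X$ with the finest group topology making the inclusion of $X$ continuous. A space $X$ is a *cf-space* if every compact subset of $X$ is finite; it is a *$\mu$-space* if every $A\subseteq X$ on which all continuous functions $f\colon X\to\mathbb R$ are bounded has compact closure. A subset $A\subseteq X$ is *$C^*$-embedded* in $X$ if every bounded continuous function $A\to\mathbb R$ extends to a bounded continuous function $X\to\mathbb R$. A set $P\subseteq X$ is a *sequential neighborhood* of $x$ if every sequence converging to $x$ is eventually in $P$. A space $X$ is *snf-countable* if to each $x\in X$ one can assign a countable family $\mathscr P_x$ of sequential neighborhoods of $x$ such that any $U,V\in\mathscr P_x$ satisfy $W\subseteq U\cap V$ for some $W\in\mathscr P_x$, and every open neighborhood $U$ of $x$ satisfies $x\in P\subseteq U$ for some $P\in\mathscr P_x$. **Theorem.** Let $X$ be a Tychonoff space such that (i) $X$ is both a cf-space and a $\mu$-space, or (ii) every countable subset of $X$ that is discrete in the subspace topology is $C^*$-embedded in $X$. Then both $F(X)$ and $A(X)$ are snf-countable. Consequently,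 for every discrete space $D$ with Stone–Čech compactification $\beta D$, both $F(\beta D)$ and $A(\beta D)$ are snf-countable. -/

import Mathlib

universe u v

open Topology Filter

/-! ### Properties of topological spaces -/

/-- A space is a *cf-space* if every compact subset of it is finite. -/
def IsCfSpace (X : Type*) [TopologicalSpace X] : Prop :=
  ∀ K : Set X, IsCompact K → K.Finite

/-- A subset `A` of `X` is *(functionally) bounded* in `X` if every continuous real-valued function
on `X` is bounded on `A`. -/
def IsFunctionallyBounded {X : Type*} [TopologicalSpace X] (A : Set X) : Prop :=
  ∀ f : C(X, ℝ), Bornology.IsBounded (f '' A)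

/-- A space is a *μ-space* if the closure of every functionally bounded subset is compact. -/
def IsMuSpace (X : Type*) [TopologicalSpace X] : Prop :=
  ∀ A : Set X, IsFunctionallyBounded A → IsCompact (closure A)

/-- A subset `A` of `X` is *C\*-embedded* in `X` if every bounded continuous real-valued function
on `A` extends to a bounded continuous real-valued function on `X`. -/
def IsCStarEmbedded {X : Type*} [TopologicalSpace X] (A : Set X) : Prop :=
  ∀ f : BoundedContinuousFunction A ℝ, ∃ g : BoundedContinuousFunction X ℝ, ∀ a : A, g a = f a

/-- `P` is a *sequential neighborhood* of `x` if every sequence converging to `x` is eventually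
in `P`. -/
def IsSequentialNhd {X : Type*} [TopologicalSpace X] (P : Set X) (x : X) : Prop :=
  ∀ s : ℕ → X, Tendsto s atTop (𝓝 x) → ∀ᶠ n in atTop, s n ∈ P

/-- The family `(N x)` of collections of subsets of `X` is an *sn-network* for `X` (the cover
in question is the union of the `N x`). -/
structure IsSnNetwork {X : Type*} [TopologicalSpace X] (N : X → Set (Set X)) : Prop where
  exists_subset_inter : ∀ x : X, ∀ U ∈ N x, ∀ V ∈ N x, ∃ W ∈ N x, W ⊆ U ∩ V
  exists_mem_subset : ∀ x : X, ∀ U : Set X, IsOpen U → x ∈ U → ∃ P ∈ N x, x ∈ P ∧ P ⊆ U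
  isSequentialNhd : ∀ x : X, ∀ P ∈ N x, IsSequentialNhd P x

/-- A space is *snf-countable* if it has an sn-network all of whose local collections are
countable. -/
def SnfCountable (X : Type*) [TopologicalSpace X] : Prop :=
  ∃ N : X → Set (Set X), IsSnNetwork N ∧ ∀ x, (N x).Countable

/-! ### Free topological groups -/

section FreeTopologicalGroups

variable (X : Type*) [TopologicalSpace X]

/-- The (Markov) *free topological group* `F(X)`: the free group on the set `X`, with the finest
group topology for which the inclusion of the generators is continuous. -/
def FreeTopologicalGroup : Type _ := FreeGroup X

namespace FreeTopologicalGroup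

instance : Group (FreeTopologicalGroup X) := inferInstanceAs (Group (FreeGroup X))

/-- The inclusion of the generators. -/
def of : X → FreeTopologicalGroup X := FreeGroup.of

instance : TopologicalSpace (FreeTopologicalGroup X) :=
  (GroupTopology.coinduced (of X)).toTopologicalSpace

instance : IsTopologicalGroup (FreeTopologicalGroup X) :=
  (GroupTopology.coinduced (of X)).toIsTopologicalGroup

theorem continuous_of : Continuous (of X) := GroupTopology.coinduced_continuous (of X)

/-- The universal property of `F(X)`. -/
theorem existsUnique_lift {H : Type*} [Group H] [TopologicalSpace H] [IsTopologicalGroup H]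
    (f : X → H) (hf : Continuous f) :
    ∃! φ : FreeTopologicalGroup X →* H, Continuous φ ∧ ∀ x, φ (of X x) = f x := by
  let φ : FreeTopologicalGroup X →* H := FreeGroup.lift f
  have hφ : ∀ x, φ (of X x) = f x := fun x => FreeGroup.lift_apply_of
  refine ⟨φ, ⟨?_, hφ⟩, ?_⟩
  · let t : GroupTopology (FreeTopologicalGroup X) :=
      { toTopologicalSpace := TopologicalSpace.induced φ inferInstance
        toIsTopologicalGroup := topologicalGroup_induced φ }
    have ht : GroupTopology.coinduced (of X) ≤ t := by
      apply sInf_le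
      change TopologicalSpace.coinduced (of X) _ ≤ TopologicalSpace.induced φ _
      rw [← continuous_iff_coinduced_le, continuous_induced_rng]
      exact hf.congr fun x => (hφ x).symm
    exact continuous_iff_le_induced.2 ht
  · rintro ψ ⟨-, hψ⟩
    exact FreeGroup.ext_hom _ _ fun x => (hψ x).trans (hφ x).symm

end FreeTopologicalGroup

/-- The (Markov) *free Abelian topological group* `A(X)`: the free Abelian group on the set `X`,
with the finest group topology for which the inclusion of the generators is continuous. -/
def FreeAbelianTopologicalGroup : Type _ := FreeAbelianGroup X

namespace FreeAbelianTopologicalGroup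

instance : AddCommGroup (FreeAbelianTopologicalGroup X) :=
  inferInstanceAs (AddCommGroup (FreeAbelianGroup X))

/-- The inclusion of the generators. -/
def of : X → FreeAbelianTopologicalGroup X := FreeAbelianGroup.of

instance : TopologicalSpace (FreeAbelianTopologicalGroup X) :=
  (AddGroupTopology.coinduced (of X)).toTopologicalSpace

instance : IsTopologicalAddGroup (FreeAbelianTopologicalGroup X) :=
  (AddGroupTopology.coinduced (of X)).toIsTopologicalAddGroup

theorem continuous_of : Continuous (of X) := AddGroupTopology.coinduced_continuous (of X)

/-- The universal property of `A(X)`. -/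
theorem existsUnique_lift {H : Type*} [AddCommGroup H] [TopologicalSpace H]
    [IsTopologicalAddGroup H] (f : X → H) (hf : Continuous f) :
    ∃! φ : FreeAbelianTopologicalGroup X →+ H, Continuous φ ∧ ∀ x, φ (of X x) = f x := by
  let φ : FreeAbelianTopologicalGroup X →+ H := FreeAbelianGroup.lift f
  have hφ : ∀ x, φ (of X x) = f x := fun x => FreeAbelianGroup.lift_apply_of f x
  refine ⟨φ, ⟨?_, hφ⟩, ?_⟩
  · let t : AddGroupTopology (FreeAbelianTopologicalGroup X) :=
      { toTopologicalSpace := TopologicalSpace.induced φ inferInstance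
        toIsTopologicalAddGroup := topologicalAddGroup_induced φ }
    have ht : AddGroupTopology.coinduced (of X) ≤ t := by
      apply sInf_le
      change TopologicalSpace.coinduced (of X) _ ≤ TopologicalSpace.induced φ _
      rw [← continuous_iff_coinduced_le, continuous_induced_rng]
      exact hf.congr fun x => (hφ x).symm
    exact continuous_iff_le_induced.2 ht
  · rintro ψ ⟨-, hψ⟩
    exact FreeAbelianGroup.lift_ext _ _ fun x => (hψ x).trans (hφ x).symm

end FreeAbelianTopologicalGroup

end FreeTopologicalGroups

/-!
Both groups are snf-countable for a drastic reason: they have no nontrivial convergent sequences,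
so the singletons form an sn-network. The argument uses only that `F(X)` and `A(X)` are generated
by `X` and functorial in the set `X`, and treats them together as instances of a
`FreeGroupFunctor`.

Let `s n → 1` with `s n ≠ 1`. Embed `X` in `βX`; the homomorphism induced on the free groups is
continuous, and injective because a one-to-one map of sets has a left inverse.

For compact `K`, the free group on `K` is Hausdorff (`exists_mem_nhds_one_notMem`): a nontrivial
word survives with probability one when its letters, placed at distinct integers by a continuous
function to `ℝ`, are kept in place while all other points are rounded after a random shift, and
the probability of survival is a continuous conjugation invariant seminorm. Moreover its topology
is determined by the compact sets of words of bounded length (`kOmegaBasis`), because the sets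
with relatively open traces on these define a group topology. So a convergent sequence has a
subsequence of bounded length, `s n = word (x n) e` with `x n : Fin l → X` and a fixed pattern `e`
of exponents.

The space `X` enters through `SeparatesSequences X`: if `a n ≠ b n` for all `n`, some continuous
function is `1` on `a n` and `0` on `b n` for infinitely many `n`. Then, along a suitable
ultrafilter, distinct letters of `x n` have distinct limits in `βX`; the word in the limits is `1`
by continuity, and substituting the letters of `x n` for their limits gives `s n = 1`
(`exists_word_eq_one`).

Sequences are separated by thinning them out until all their points together form a discrete set
(`CanAvoidPoints.exists_discrete`). Under the second hypothesis, this set is C*-embedded. Under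
the first, infinite sets are not functionally bounded, so that some continuous function tends to
infinity along the sequences and locally finite sums of bumps are available. Finally, countable
discrete subsets of `βD` are C*-embedded because their points have disjoint neighborhoods, to
whose traces on `D` a function can be spread.
-/

open scoped Pointwise

/-! ### Free groups in a functorial setting -/

/-- The common features of the constructions `X ↦ FreeGroup X` and
`X ↦ Multiplicative (FreeAbelianGroup X)`: a group depending functorially on a set and generated by
an image of it. Freeness itself plays no role, only functoriality under arbitrary maps of sets. -/
structure FreeGroupFunctor where
  /-- The group attached to a set. -/
  obj : Type u → Type u
  [group : ∀ X, Group (obj X)]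
  /-- The generators. -/
  of : ∀ {X : Type u}, X → obj X
  /-- The homomorphism induced by a map of generators. -/
  map : ∀ {X Y : Type u}, (X → Y) → (obj X →* obj Y)
  map_of : ∀ {X Y : Type u} (f : X → Y) (x : X), map f (of x) = of (f x)
  closure_range_of : ∀ X : Type u, Subgroup.closure (Set.range (of : X → obj X)) = ⊤

namespace FreeGroupFunctor

attribute [instance] FreeGroupFunctor.group

variable (Φ : FreeGroupFunctor.{u}) {X Y Z : Type u}

theorem map_map (g : Y → Z) (f : X → Y) (a : Φ.obj X) :
    Φ.map g (Φ.map f a) = Φ.map (g ∘ f) a := by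
  have : (Φ.map g).comp (Φ.map f) = Φ.map (g ∘ f) :=
    MonoidHom.eq_of_eqOn_dense (Φ.closure_range_of X) (by
      rintro _ ⟨x, rfl⟩
      simp [Φ.map_of])
  exact DFunLike.congr_fun this a

theorem map_id (a : Φ.obj X) : Φ.map id a = a := by
  have : Φ.map id = MonoidHom.id (Φ.obj X) :=
    MonoidHom.eq_of_eqOn_dense (Φ.closure_range_of X) (by
      rintro _ ⟨x, rfl⟩
      simp [Φ.map_of])
  exact DFunLike.congr_fun this a

theorem eq_one_of_isEmpty [IsEmpty X] (a : Φ.obj X) : a = 1 := by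
  have h := Φ.closure_range_of X
  rw [Set.range_eq_empty, Subgroup.closure_empty] at h
  have ha : a ∈ (⊥ : Subgroup (Φ.obj X)) := h ▸ Subgroup.mem_top a
  exact ha

theorem map_injective {f : X → Y} (hf : f.Injective) : Function.Injective (Φ.map f) := by
  intro a b hab
  cases isEmpty_or_nonempty X
  · rw [Φ.eq_one_of_isEmpty a, Φ.eq_one_of_isEmpty b]
  · have := congrArg (Φ.map (Function.invFun f)) hab
    simpa [Φ.map_map, Function.invFun_comp hf, Φ.map_id] using this

/-! ### Words -/

/-- The product of `l` letters, the `i`-th being `x i`, its inverse or the identity, according to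
the value `1`, `-1` or `0` of `e i`. -/
def word {l : ℕ} (x : Fin l → X) (e : Fin l → SignType) : Φ.obj X :=
  (List.ofFn fun i => Φ.of (x i) ^ ((e i : SignType) : ℤ)).prod

theorem map_word (f : X → Y) {l : ℕ} (x : Fin l → X) (e : Fin l → SignType) :
    Φ.map f (Φ.word x e) = Φ.word (f ∘ x) e := by
  simp [word, map_list_prod, List.map_ofFn, Function.comp_def, Φ.map_of]

variable (X) in
/-- The elements represented by words of length at most one. -/
def letters : Set (Φ.obj X) := {1} ∪ (Set.range Φ.of ∪ (Set.range Φ.of)⁻¹)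

theorem one_mem_letters : (1 : Φ.obj X) ∈ Φ.letters X := Or.inl rfl

theorem of_mem_letters (x : X) : Φ.of x ∈ Φ.letters X := Or.inr (Or.inl ⟨x, rfl⟩)

theorem inv_letters : (Φ.letters X)⁻¹ = Φ.letters X := by
  simp [letters, Set.union_inv, Set.union_comm]

theorem exists_mem_letters_pow (a : Φ.obj X) : ∃ n : ℕ, a ∈ Φ.letters X ^ n := by
  have ha : a ∈ Subgroup.closure (Set.range (Φ.of : X → Φ.obj X)) :=
    Φ.closure_range_of X ▸ Subgroup.mem_top a
  induction ha using Subgroup.closure_induction with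
  | mem a ha =>
    obtain ⟨x, rfl⟩ := ha
    exact ⟨1, by simpa using Φ.of_mem_letters x⟩
  | one => exact ⟨0, by simp⟩
  | mul a b _ _ iha ihb =>
    obtain ⟨m, hm⟩ := iha
    obtain ⟨n, hn⟩ := ihb
    exact ⟨m + n, pow_add (Φ.letters X) m n ▸ Set.mul_mem_mul hm hn⟩
  | inv a _ ih =>
    obtain ⟨n, hn⟩ := ih
    refine ⟨n, ?_⟩
    rw [← Φ.inv_letters, inv_pow]
    exact Set.inv_mem_inv.2 hn

theorem map_mem_letters_pow (f : X → Y) {n : ℕ} {a : Φ.obj X} (ha : a ∈ Φ.letters X ^ n) :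
    Φ.map f a ∈ Φ.letters Y ^ n := by
  have h : Φ.map f '' Φ.letters X ⊆ Φ.letters Y := by
    rintro _ ⟨b, rfl | ⟨x, rfl⟩ | ⟨x, hx⟩, rfl⟩
    · simpa using Φ.one_mem_letters
    · simpa [Φ.map_of] using Φ.of_mem_letters (f x)
    · refine Or.inr (Or.inr ⟨f x, ?_⟩)
      rw [← Φ.map_of, hx, map_inv]
  have := Set.mem_image_of_mem (Φ.map f) ha
  rw [Set.image_pow] at this
  exact Set.pow_subset_pow_left h this

theorem exists_word_of_mem_letters_pow [Nonempty X] {n : ℕ} {a : Φ.obj X}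
    (ha : a ∈ Φ.letters X ^ n) : ∃ (x : Fin n → X) (e : Fin n → SignType), a = Φ.word x e := by
  induction n generalizing a with
  | zero => exact ⟨Fin.elim0, Fin.elim0, by simpa [word] using ha⟩
  | succ n ih =>
    rw [pow_succ'] at ha
    obtain ⟨b, hb, c, hc, rfl⟩ := Set.mem_mul.1 ha
    obtain ⟨x, e, rfl⟩ := ih hc
    obtain ⟨y, d, rfl⟩ : ∃ (y : X) (d : SignType), b = Φ.of y ^ ((d : SignType) : ℤ) := by
      rcases hb with rfl | ⟨y, rfl⟩ | ⟨y, hy⟩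
      · exact ⟨Classical.arbitrary X, 0, by simp⟩
      · exact ⟨y, 1, by simp⟩
      · exact ⟨y, -1, by simp [hy]⟩
    exact ⟨Fin.cons y x, Fin.cons d e, by simp [word, List.ofFn_succ]⟩

theorem exists_word [Nonempty X] (a : Φ.obj X) :
    ∃ (n : ℕ) (x : Fin n → X) (e : Fin n → SignType), a = Φ.word x e := by
  obtain ⟨n, hn⟩ := Φ.exists_mem_letters_pow a
  exact ⟨n, Φ.exists_word_of_mem_letters_pow hn⟩

/-! ### The free group topology -/

instance [TopologicalSpace X] : TopologicalSpace (Φ.obj X) :=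
  (GroupTopology.coinduced (Φ.of : X → Φ.obj X)).toTopologicalSpace

instance [TopologicalSpace X] : IsTopologicalGroup (Φ.obj X) :=
  (GroupTopology.coinduced (Φ.of : X → Φ.obj X)).toIsTopologicalGroup

theorem continuous_of [TopologicalSpace X] : Continuous (Φ.of : X → Φ.obj X) :=
  GroupTopology.coinduced_continuous _

theorem topology_le [TopologicalSpace X] (t : GroupTopology (Φ.obj X))
    (ht : Continuous[_, t.toTopologicalSpace] (Φ.of : X → Φ.obj X)) :
    (inferInstance : TopologicalSpace (Φ.obj X)) ≤ t.toTopologicalSpace := by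
  have : GroupTopology.coinduced (Φ.of : X → Φ.obj X) ≤ t :=
    sInf_le (continuous_iff_coinduced_le.1 ht)
  exact this

theorem continuous_of_comp_of [TopologicalSpace X] {H : Type*} [Group H] [TopologicalSpace H]
    [IsTopologicalGroup H] (φ : Φ.obj X →* H) (hφ : Continuous fun x => φ (Φ.of x)) :
    Continuous φ := by
  let t : GroupTopology (Φ.obj X) :=
    { toTopologicalSpace := TopologicalSpace.induced φ inferInstance
      toIsTopologicalGroup := topologicalGroup_induced φ }
  exact continuous_iff_le_induced.2 (Φ.topology_le t (continuous_induced_rng.2 hφ))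

theorem continuous_map [TopologicalSpace X] [TopologicalSpace Y] {f : X → Y} (hf : Continuous f) :
    Continuous (Φ.map f) :=
  Φ.continuous_of_comp_of _ (by
    simp only [Φ.map_of]
    exact Φ.continuous_of.comp hf)

theorem continuous_word [TopologicalSpace X] {l : ℕ} (e : Fin l → SignType) :
    Continuous fun x : Fin l → X => Φ.word x e := by
  induction l with
  | zero => simpa [word] using continuous_const
  | succ l ih =>
    simp only [word, List.ofFn_succ, List.prod_cons]
    refine Continuous.mul ((Φ.continuous_of.comp (continuous_apply 0)).zpow _) ?_
    exact (ih fun i => e i.succ).comp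
      (continuous_pi fun i : Fin l => continuous_apply (A := fun _ => X) i.succ)

/-- A neighborhood base of the identity for a coarser group topology consists of neighborhoods
of the identity in the free group topology. -/
theorem mem_nhds_one_of_groupFilterBasis [TopologicalSpace X] (B : GroupFilterBasis (Φ.obj X))
    (hB : ∀ V ∈ B, ∀ x₀ : X, ∀ᶠ x in 𝓝 x₀, (Φ.of x₀)⁻¹ * Φ.of x ∈ V)
    {V : Set (Φ.obj X)} (hV : V ∈ B) : V ∈ 𝓝 (1 : Φ.obj X) := by
  let t : GroupTopology (Φ.obj X) :=
    { toTopologicalSpace := B.topology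
      toIsTopologicalGroup := B.isTopologicalGroup }
  have ht : Continuous[_, t.toTopologicalSpace] (Φ.of : X → Φ.obj X) := by
    let _ := B.topology
    refine continuous_iff_continuousAt.2 fun x₀ => ?_
    refine (B.nhds_hasBasis (Φ.of x₀)).tendsto_right_iff.2 fun W hW => ?_
    filter_upwards [hB W hW x₀] with x hx
    exact ⟨_, hx, by simp⟩
  exact nhds_mono (Φ.topology_le t ht) (B.mem_nhds_one hV)

end FreeGroupFunctor

/-! ### Separation -/

open MeasureTheory in
/-- For all but few shifts `t`, the translates by `t` of two nearby points are not separated by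
the integer grid. -/
theorem volume_floor_add_ne_le {r s δ : ℝ} (h : |r - s| < δ) (hδ : δ ≤ 1) :
    volume {t ∈ Set.Ico (0 : ℝ) 1 | ⌊r + t⌋ ≠ ⌊s + t⌋} ≤ 3 * ENNReal.ofReal (2 * δ) := by
  have hsub : {t ∈ Set.Ico (0 : ℝ) 1 | ⌊r + t⌋ ≠ ⌊s + t⌋} ⊆
      ⋃ j ∈ Finset.range 3, Metric.closedBall (⌊s⌋ + (j : ℝ) - s) δ := by
    rintro t ⟨⟨ht0, ht1⟩, hne⟩
    -- the grid point `k` lies between `r + t` and `s + t`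
    obtain ⟨k, hk1, hk2⟩ : ∃ k : ℤ, -δ < k - s - t ∧ k - s - t < δ := by
      rw [abs_lt] at h
      rcases lt_or_gt_of_ne hne with hlt | hlt
      · have h1 := Int.floor_le (s + t)
        have h2 : r + t < ⌊s + t⌋ := Int.floor_lt.1 hlt
        exact ⟨⌊s + t⌋, by linarith, by linarith⟩
      · have h1 := Int.floor_le (r + t)
        have h2 : s + t < ⌊r + t⌋ := Int.floor_lt.1 hlt
        exact ⟨⌊r + t⌋, by linarith, by linarith⟩
    have hs1 := Int.floor_le s
    have hs2 := Int.lt_floor_add_one s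
    have hlow : ⌊s⌋ < k + 1 := by
      have : (⌊s⌋ : ℝ) < k + 1 := by linarith
      exact_mod_cast this
    have hhigh : k < ⌊s⌋ + 3 := by
      have : (k : ℝ) < ⌊s⌋ + 3 := by linarith
      exact_mod_cast this
    obtain ⟨j, hj⟩ := Int.eq_ofNat_of_zero_le (show 0 ≤ k - ⌊s⌋ by omega)
    have hj' : (⌊s⌋ : ℝ) + (j : ℝ) = k := by
      have : ⌊s⌋ + (j : ℤ) = k := by omega
      exact_mod_cast this
    refine Set.mem_biUnion (x := j) (Finset.mem_coe.2 (Finset.mem_range.2 (by omega))) ?_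
    rw [Metric.mem_closedBall, Real.dist_eq, hj', abs_le]
    constructor <;> linarith
  calc _ ≤ _ := measure_mono hsub
    _ ≤ _ := measure_biUnion_finset_le _ _
    _ = _ := by simp

namespace FreeGroupFunctor

variable (Φ : FreeGroupFunctor.{u}) {X Y Z : Type u}

/-- The shifts `t ∈ [0, 1)` for which the substitution `f t` does not kill `a`. -/
def support (f : ℝ → X → Y) (a : Φ.obj X) : Set ℝ :=
  {t ∈ Set.Ico (0 : ℝ) 1 | Φ.map (f t) a ≠ 1}

open MeasureTheory in
/-- The conjugation invariant neighborhoods of `1` given by a random substitution `f`: the elements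
surviving with probability less than `ε`. Probabilities are outer measures, and `f` need not be
measurable in any sense. -/
@[reducible]
def substitutionBasis (f : ℝ → X → Y) : GroupFilterBasis (Φ.obj X) where
  sets := {V | ∃ ε : ENNReal, 0 < ε ∧ V = {a | volume (Φ.support f a) < ε}}
  nonempty := ⟨_, 1, one_pos, rfl⟩
  inter_sets := by
    rintro _ _ ⟨ε, hε, rfl⟩ ⟨δ, hδ, rfl⟩
    refine ⟨_, ⟨min ε δ, lt_min hε hδ, rfl⟩, fun a ha => ?_⟩
    simpa only [Set.mem_inter_iff, Set.mem_ofPred_eq, lt_min_iff] using ha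
  one' := by
    rintro _ ⟨ε, hε, rfl⟩
    simpa [support] using hε
  mul' := by
    rintro _ ⟨ε, hε, rfl⟩
    refine ⟨_, ⟨ε / 2, ENNReal.half_pos hε.ne', rfl⟩, ?_⟩
    rintro _ ⟨a, ha, b, hb, rfl⟩
    have hsub : Φ.support f (a * b) ⊆ Φ.support f a ∪ Φ.support f b := by
      rintro t ⟨ht, hab⟩
      by_contra hnot
      simp only [support, Set.mem_union, Set.mem_ofPred_eq, not_or, not_and, not_not] at hnot
      exact hab (by rw [map_mul, hnot.1 ht, hnot.2 ht, one_mul])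
    calc volume (Φ.support f (a * b)) ≤ volume (Φ.support f a) + volume (Φ.support f b) :=
          (measure_mono hsub).trans (measure_union_le _ _)
      _ < ε / 2 + ε / 2 := ENNReal.add_lt_add ha hb
      _ = ε := ENNReal.add_halves ε
  inv' := by
    rintro _ ⟨ε, hε, rfl⟩
    exact ⟨_, ⟨ε, hε, rfl⟩, fun a ha => by simpa [support] using ha⟩
  conj' := by
    rintro b _ ⟨ε, hε, rfl⟩
    exact ⟨_, ⟨ε, hε, rfl⟩, fun a ha => by simpa [support] using ha⟩

open MeasureTheory in
/-- A continuous real-valued function that is injective and integer-valued on the letters of a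
word yields, by rounding after a random shift, a random substitution that fixes the word with
probability one. -/
theorem exists_mem_nhds_one_notMem [TopologicalSpace X] [CompactSpace X] [T2Space X]
    {a : Φ.obj X} (ha : a ≠ 1) : ∃ V ∈ 𝓝 (1 : Φ.obj X), a ∉ V := by
  rcases isEmpty_or_nonempty X with hX | ⟨⟨x₀⟩⟩
  · exact absurd (Φ.eq_one_of_isEmpty a) ha
  have : Nonempty X := ⟨x₀⟩
  obtain ⟨n, x, e, rfl⟩ := Φ.exists_word a
  let S : Set X := Set.range x
  have hS : S.Finite := Set.finite_range x
  have : Finite S := hS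
  obtain ⟨i, hi⟩ := exists_injective_nat S
  let j : S → ℤ := fun s => (i s : ℤ)
  have hj : j.Injective := fun s t hst => hi (Int.ofNat_inj.1 hst)
  obtain ⟨h, hh⟩ := ContinuousMap.exists_restrict_eq hS.isClosed
    (⟨fun s => (j s : ℝ), continuous_of_discreteTopology⟩ : C(S, ℝ))
  let f : ℝ → X → X := fun t z => Function.extend j Subtype.val (fun _ => x₀) ⌊h z + t⌋
  have hf : ∀ t ∈ Set.Ico (0 : ℝ) 1, ∀ k, f t (x k) = x k := by
    intro t ht k
    have hk : h (x k) = j ⟨x k, k, rfl⟩ :=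
      DFunLike.congr_fun hh (⟨x k, k, rfl⟩ : S)
    have hfl : ⌊h (x k) + t⌋ = j ⟨x k, k, rfl⟩ := by
      rw [hk, Int.floor_intCast_add, Int.floor_eq_zero_iff.2 ht, add_zero]
    simp only [f]
    rw [hfl, hj.extend_apply]
  refine ⟨{b | volume (Φ.support f b) < 1}, ?_, ?_⟩
  · refine Φ.mem_nhds_one_of_groupFilterBasis (Φ.substitutionBasis f) ?_ ⟨1, one_pos, rfl⟩
    rintro _ ⟨ε, hε, rfl⟩ y
    obtain ⟨δ, ⟨hδε, hδ1⟩, hδ0⟩ : ∃ δ : ℝ, (3 * ENNReal.ofReal (2 * δ) < ε ∧ δ ≤ 1) ∧ 0 < δ := by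
      have hlim : Tendsto (fun δ : ℝ => 3 * ENNReal.ofReal (2 * δ)) (𝓝[>] 0) (𝓝 0) := by
        have hc : Continuous fun δ : ℝ => 3 * ENNReal.ofReal (2 * δ) :=
          (ENNReal.continuous_const_mul (by simp)).comp
            (ENNReal.continuous_ofReal.comp (by fun_prop))
        simpa using (hc.tendsto 0).mono_left nhdsWithin_le_nhds
      have h1 : ∀ᶠ δ : ℝ in 𝓝[>] 0, δ ≤ 1 :=
        nhdsWithin_le_nhds (Iic_mem_nhds one_pos)
      exact (((hlim.eventually_lt_const hε).and h1).and self_mem_nhdsWithin).exists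
    have hnear : ∀ᶠ z in 𝓝 y, |h z - h y| < δ := by
      have := Metric.tendsto_nhds.1 (h.continuous.tendsto y) δ hδ0
      simpa only [Real.dist_eq] using this
    filter_upwards [hnear] with z hz
    refine lt_of_le_of_lt (measure_mono ?_) ((volume_floor_add_ne_le hz hδ1).trans_lt hδε)
    rintro t ⟨ht, hne⟩
    refine ⟨ht, fun hfl => hne ?_⟩
    simp [Φ.map_of, f, hfl]
  · have hsupp : Φ.support f (Φ.word x e) = Set.Ico (0 : ℝ) 1 := by
      refine Set.Subset.antisymm (fun t ht => ht.1) fun t ht => ⟨ht, ?_⟩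
      rwa [Φ.map_word, show f t ∘ x = x from funext (hf t ht)]
    simp [hsupp]

instance [TopologicalSpace X] [CompactSpace X] [T2Space X] : T2Space (Φ.obj X) := by
  suffices T1Space (Φ.obj X) by infer_instance
  refine IsTopologicalGroup.t1Space _ ?_
  rw [← isOpen_compl_iff, isOpen_iff_mem_nhds]
  intro a ha
  obtain ⟨V, hV, haV⟩ := Φ.exists_mem_nhds_one_notMem ha
  have hc : Tendsto (fun b : Φ.obj X => b⁻¹ * a) (𝓝 a) (𝓝 1) := by
    have : Continuous fun b : Φ.obj X => b⁻¹ * a := by fun_prop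
    simpa using this.tendsto a
  filter_upwards [hc hV] with b hb hb1
  rw [Set.mem_singleton_iff] at hb1
  subst hb1
  simp only [Set.mem_preimage, inv_one, one_mul] at hb
  exact haV hb

end FreeGroupFunctor

/-! ### Groups exhausted by powers of a compact set -/

/-- The subsets of a group whose traces on all powers of `L` are relatively open form a base of
neighborhoods of the identity for a group topology, if `L` is compact. -/
@[reducible]
def kOmegaBasis {G : Type*} [Group G] [TopologicalSpace G] [IsTopologicalGroup G] [T2Space G]
    (L : Set G) (hL : IsCompact L) (h1 : 1 ∈ L) (hinv : L⁻¹ = L) (hex : ∀ a, ∃ n : ℕ, a ∈ L ^ n) :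
    GroupFilterBasis G where
  sets := {V | 1 ∈ V ∧ ∀ n : ℕ, ∃ O, IsOpen O ∧ V ∩ L ^ n = O ∩ L ^ n}
  nonempty := ⟨Set.univ, trivial, fun n => ⟨Set.univ, isOpen_univ, rfl⟩⟩
  inter_sets := by
    rintro U V ⟨hU1, hU⟩ ⟨hV1, hV⟩
    refine ⟨U ∩ V, ⟨⟨hU1, hV1⟩, fun n => ?_⟩, subset_rfl⟩
    obtain ⟨O, hO, hUO⟩ := hU n
    obtain ⟨P, hP, hVP⟩ := hV n
    refine ⟨O ∩ P, hO.inter hP, ?_⟩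
    rw [Set.inter_inter_distrib_right, hUO, hVP, ← Set.inter_inter_distrib_right]
  one' := fun hU => hU.1
  mul' := by
    rintro U ⟨hU1, hU⟩
    have hmono : Monotone fun n : ℕ => L ^ n := Set.pow_right_monotone h1
    have hpow : ∀ n : ℕ, IsCompact (L ^ n) := by
      intro n
      induction n with
      | zero => simp
      | succ n ih => exact pow_succ L n ▸ ih.mul hL
    -- A compact `K` with `K * K ⊆ U` has a neighborhood in any given power with the same property.
    have step : ∀ (n : ℕ) (K : Set G), IsCompact K → K ⊆ L ^ n → K * K ⊆ U →
        ∃ W, IsOpen W ∧ K ⊆ W ∧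
          (closure W ∩ L ^ (n + 1)) * (closure W ∩ L ^ (n + 1)) ⊆ U := by
      intro n K hK hKn hKU
      obtain ⟨O, hO, hUO⟩ := hU ((n + 1) + (n + 1))
      have hKO : K ×ˢ K ⊆ (fun p : G × G => p.1 * p.2) ⁻¹' O := by
        rintro ⟨a, b⟩ ⟨ha, hb⟩
        have hab : a * b ∈ U ∩ L ^ ((n + 1) + (n + 1)) :=
          ⟨hKU (Set.mul_mem_mul ha hb), by
            rw [pow_add]
            exact Set.mul_mem_mul (hmono n.le_succ (hKn ha)) (hmono n.le_succ (hKn hb))⟩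
        exact (hUO ▸ hab).1
      obtain ⟨P, Q, hP, hQ, hKP, hKQ, hPQ⟩ :=
        generalized_tube_lemma hK hK (hO.preimage continuous_mul) hKO
      obtain ⟨W, hW, hKW, hWPQ⟩ := hK.exists_isOpen_closure_subset
        ((hP.inter hQ).mem_nhdsSet.2 (Set.subset_inter hKP hKQ))
      refine ⟨W, hW, hKW, ?_⟩
      rintro _ ⟨a, ha, b, hb, rfl⟩
      have hab : a * b ∈ O ∩ L ^ ((n + 1) + (n + 1)) :=
        ⟨hPQ (Set.mk_mem_prod (hWPQ ha.1).1 (hWPQ hb.1).2), by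
          rw [pow_add]
          exact Set.mul_mem_mul ha.2 hb.2⟩
      exact (hUO ▸ hab).1
    choose! W hWo hKW hWU using step
    let K : ℕ → Set G := fun n =>
      Nat.rec {1} (fun n K => closure (W n K) ∩ L ^ (n + 1)) n
    have hK : ∀ n, IsCompact (K n) ∧ K n ⊆ L ^ n ∧ K n * K n ⊆ U := by
      intro n
      induction n with
      | zero => exact ⟨isCompact_singleton, by simp [K], by simpa [K] using hU1⟩
      | succ n ih =>
        exact ⟨(hpow (n + 1)).inter_left isClosed_closure, Set.inter_subset_right,
          hWU n (K n) ih.1 ih.2.1 ih.2.2⟩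
    have hKsucc : ∀ n, K n ⊆ K (n + 1) := fun n a ha =>
      ⟨subset_closure (hKW n (K n) (hK n).1 (hK n).2.1 (hK n).2.2 ha),
        hmono n.le_succ ((hK n).2.1 ha)⟩
    have hKmono : Monotone K := monotone_nat_of_le_succ hKsucc
    refine ⟨⋃ n, K n, ⟨Set.mem_iUnion.2 ⟨0, rfl⟩, fun n => ?_⟩, ?_⟩
    · refine ⟨⋃ m ≥ n, W m (K m),
        isOpen_biUnion fun m _ => hWo m (K m) (hK m).1 (hK m).2.1 (hK m).2.2, ?_⟩
      ext a
      simp only [Set.mem_inter_iff, Set.mem_iUnion, and_congr_left_iff]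
      intro han
      constructor
      · rintro ⟨m, hm⟩
        have hm' := hKmono (le_max_left m n) hm
        exact ⟨max m n, le_max_right m n,
          hKW _ _ (hK _).1 (hK _).2.1 (hK _).2.2 hm'⟩
      · rintro ⟨m, hmn, hm⟩
        exact ⟨m + 1, subset_closure hm, hmono (hmn.trans m.le_succ) han⟩
    · rintro _ ⟨a, ha, b, hb, rfl⟩
      obtain ⟨m, hm⟩ := Set.mem_iUnion.1 ha
      obtain ⟨n, hn⟩ := Set.mem_iUnion.1 hb
      exact (hK (max m n)).2.2 (Set.mul_mem_mul (hKmono (le_max_left m n) hm)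
        (hKmono (le_max_right m n) hn))
  inv' := by
    rintro U ⟨hU1, hU⟩
    refine ⟨U⁻¹, ⟨by simpa using hU1, fun n => ?_⟩, subset_rfl⟩
    obtain ⟨O, hO, hUO⟩ := hU n
    refine ⟨O⁻¹, hO.inv, ?_⟩
    have hLn : (L ^ n)⁻¹ = L ^ n := by rw [← inv_pow, hinv]
    rw [← hLn, ← Set.inter_inv, ← Set.inter_inv, hUO]
  conj' := by
    rintro b U ⟨hU1, hU⟩
    refine ⟨(fun a => b * a * b⁻¹) ⁻¹' U, ⟨by simpa using hU1, fun n => ?_⟩, subset_rfl⟩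
    obtain ⟨k, hk⟩ := hex b
    have hk' : b⁻¹ ∈ L ^ k := by
      rw [← hinv, inv_pow]
      exact Set.inv_mem_inv.2 hk
    obtain ⟨O, hO, hUO⟩ := hU (k + n + k)
    refine ⟨(fun a => b * a * b⁻¹) ⁻¹' O, hO.preimage (by fun_prop), ?_⟩
    ext a
    simp only [Set.mem_inter_iff, Set.mem_preimage, and_congr_left_iff]
    intro ha
    have hmem : b * a * b⁻¹ ∈ L ^ (k + n + k) := by
      rw [pow_add, pow_add]
      exact Set.mul_mem_mul (Set.mul_mem_mul hk ha) hk'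
    have := Set.ext_iff.1 hUO (b * a * b⁻¹)
    simpa [hmem] using this

namespace FreeGroupFunctor

variable (Φ : FreeGroupFunctor.{u}) {X Y Z : Type u}

theorem isCompact_letters [TopologicalSpace X] [CompactSpace X] : IsCompact (Φ.letters X) := by
  have h : IsCompact (Set.range (Φ.of : X → Φ.obj X)) := isCompact_range Φ.continuous_of
  exact isCompact_singleton.union (h.union h.inv)

/-- A set having finitely many elements of each word length is closed in the free group on a
compact space. -/
theorem compl_mem_nhds_one [TopologicalSpace X] [CompactSpace X] [T2Space X] {S : Set (Φ.obj X)}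
    (hS1 : 1 ∉ S) (hS : ∀ n : ℕ, (S ∩ Φ.letters X ^ n).Finite) : Sᶜ ∈ 𝓝 (1 : Φ.obj X) := by
  refine Φ.mem_nhds_one_of_groupFilterBasis (kOmegaBasis (Φ.letters X) Φ.isCompact_letters
    Φ.one_mem_letters Φ.inv_letters Φ.exists_mem_letters_pow) ?_ ⟨hS1, fun n => ?_⟩
  · rintro V ⟨hV1, hV⟩ x₀
    obtain ⟨O, hO, hVO⟩ := hV (1 + 1)
    have h1 : (1 : Φ.obj X) ∈ O := by
      have : (1 : Φ.obj X) ∈ V ∩ Φ.letters X ^ (1 + 1) :=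
        ⟨hV1, Set.one_mem_pow Φ.one_mem_letters⟩
      exact (hVO ▸ this).1
    have hc : Tendsto (fun x => (Φ.of x₀)⁻¹ * Φ.of x) (𝓝 x₀) (𝓝 1) := by
      have : Continuous fun x => (Φ.of x₀)⁻¹ * Φ.of x := continuous_const.mul Φ.continuous_of
      simpa using this.tendsto x₀
    filter_upwards [hc (hO.mem_nhds h1)] with x hx
    have hmem : (Φ.of x₀)⁻¹ * Φ.of x ∈ O ∩ Φ.letters X ^ (1 + 1) := by
      refine ⟨hx, ?_⟩
      rw [pow_add, pow_one]
      exact Set.mul_mem_mul (Or.inr (Or.inr (by simp))) (Φ.of_mem_letters x)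
    exact (hVO ▸ hmem).1
  · refine ⟨(S ∩ Φ.letters X ^ n)ᶜ, (hS n).isClosed.isOpen_compl, ?_⟩
    ext a
    simp only [Set.mem_inter_iff, Set.mem_compl_iff]
    tauto

end FreeGroupFunctor

/-! ### Triviality of convergent sequences -/

theorem Set.Infinite.exists_infinite_fiber {β α : Type*} [Finite α] {B : Set β} (hB : B.Infinite)
    (f : β → α) : ∃ c, {n ∈ B | f n = c}.Infinite := by
  by_contra! h
  refine hB ((Set.finite_iUnion h).subset fun n hn => ?_)
  exact Set.mem_iUnion.2 ⟨f n, hn, rfl⟩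

/-- Any two sequences of points of `X` with distinct terms of equal index can be told apart, along
a subsequence, by a continuous real-valued function. Subsequences are encoded by infinite sets of
indices. -/
def SeparatesSequences (X : Type*) [TopologicalSpace X] : Prop :=
  ∀ (a b : ℕ → X) (B : Set ℕ), B.Infinite → (∀ n ∈ B, a n ≠ b n) →
    ∃ h : C(X, ℝ), ∃ A ⊆ B, A.Infinite ∧ ∀ n ∈ A, h (a n) = 1 ∧ h (b n) = 0

theorem SeparatesSequences.exists_forall_pair {X : Type*} [TopologicalSpace X]
    (hX : SeparatesSequences X) {ι : Type*} (x : ℕ → ι → X) {B : Set ℕ} (hB : B.Infinite)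
    (P : Finset (ι × ι)) :
    ∃ A ⊆ B, A.Infinite ∧ ∀ p ∈ P, (∀ n ∈ A, x n p.1 = x n p.2) ∨
      ∃ h : C(X, ℝ), ∀ n ∈ A, h (x n p.1) = 1 ∧ h (x n p.2) = 0 := by
  classical
  induction P using Finset.induction_on with
  | empty => exact ⟨B, subset_rfl, hB, by simp⟩
  | insert q P _ ih =>
    obtain ⟨A, hAB, hA, hP⟩ := ih
    -- It suffices to pass to a further infinite set on which the new pair is dealt with.
    suffices ∃ A' ⊆ A, A'.Infinite ∧ ((∀ n ∈ A', x n q.1 = x n q.2) ∨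
        ∃ h : C(X, ℝ), ∀ n ∈ A', h (x n q.1) = 1 ∧ h (x n q.2) = 0) by
      obtain ⟨A', hA'A, hA', hq⟩ := this
      refine ⟨A', hA'A.trans hAB, hA', fun p hp => ?_⟩
      rcases Finset.mem_insert.1 hp with rfl | hp
      · exact hq
      · exact (hP p hp).imp (fun h n hn => h n (hA'A hn))
          (Exists.imp fun h hh n hn => hh n (hA'A hn))
    by_cases heq : {n ∈ A | x n q.1 = x n q.2}.Infinite
    · exact ⟨_, Set.sep_subset _ _, heq, Or.inl fun n hn => hn.2⟩
    · have hne : {n ∈ A | x n q.1 ≠ x n q.2}.Infinite := by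
        have := hA.sdiff (Set.not_infinite.1 heq)
        refine this.mono fun n hn => ⟨hn.1, fun h => hn.2 ⟨hn.1, h⟩⟩
      obtain ⟨h, A', hA'A, hA', hh⟩ := hX (fun n => x n q.1) (fun n => x n q.2) _ hne
        fun n hn => hn.2
      exact ⟨A', hA'A.trans (Set.sep_subset _ _), hA', Or.inr ⟨h, hh⟩⟩

namespace FreeGroupFunctor

variable (Φ : FreeGroupFunctor.{u}) {X : Type u}

/-- If the words `Φ.word (x n) e` tend to `1`, then so does the word in the limits `v j` of the
letters, taken in the Stone–Čech compactification along an ultrafilter. Separation of sequences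
makes sure that letters that differ have different limits, so the words can be recovered from
their limit. -/
theorem exists_word_eq_one [TopologicalSpace X] [T35Space X] [Nonempty X]
    (hX : SeparatesSequences X) {l : ℕ} (x : ℕ → Fin l → X) (e : Fin l → SignType)
    {B : Set ℕ} (hB : B.Infinite)
    (hlim : Tendsto (fun n => Φ.word (stoneCechUnit ∘ x n) e) (atTop ⊓ 𝓟 B) (𝓝 1)) :
    ∃ n ∈ B, Φ.word (x n) e = 1 := by
  obtain ⟨A, hAB, hA, hsep⟩ := hX.exists_forall_pair x hB Finset.univ
  have : (atTop ⊓ 𝓟 A).NeBot := by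
    rw [← frequently_mem_iff_neBot]
    exact Nat.frequently_atTop_iff_infinite.2 hA
  let U := Ultrafilter.of (atTop ⊓ 𝓟 A)
  have hU : (U : Filter ℕ) ≤ atTop ⊓ 𝓟 A := Ultrafilter.of_le _
  have hUA : A ∈ U := hU (mem_inf_of_right (mem_principal_self A))
  have hconv : ∀ j, ∃ y, Tendsto (fun n => (stoneCechUnit (x n j) : StoneCech X)) U (𝓝 y) := by
    intro j
    obtain ⟨y, -, hy⟩ := isCompact_univ.ultrafilter_le_nhds
      (U.map fun n => (stoneCechUnit (x n j) : StoneCech X)) (by simp)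
    exact ⟨y, hy⟩
  choose v hv using hconv
  have hword : Φ.word v e = 1 := by
    have h1 : Tendsto (fun n => Φ.word (stoneCechUnit ∘ x n) e) U (𝓝 (Φ.word v e)) :=
      ((Φ.continuous_word e).tendsto v).comp (tendsto_pi_nhds.2 hv)
    exact tendsto_nhds_unique h1
      (hlim.mono_left (hU.trans (inf_le_inf_left _ (principal_mono.2 hAB))))
  obtain ⟨n, hn⟩ := hA.nonempty
  refine ⟨n, hAB hn, ?_⟩
  have hfac : (x n).FactorsThrough v := by
    intro i j hij
    rcases hsep (i, j) (Finset.mem_univ _) with h | ⟨h, hh⟩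
    · exact h n hn
    · exfalso
      let g : X → unitInterval := fun y => Set.projIcc 0 1 zero_le_one (h y)
      have hg : Continuous g := continuous_projIcc.comp h.continuous
      have hext : ∀ k c, (∀ m ∈ A, g (x m k) = c) → stoneCechExtend hg (v k) = c := by
        intro k c hc
        have h1 := ((continuous_stoneCechExtend hg).tendsto (v k)).comp (hv k)
        refine tendsto_nhds_unique h1 (tendsto_const_nhds.congr' ?_)
        filter_upwards [hUA] with m hm
        rw [Function.comp_apply, stoneCechExtend_stoneCechUnit, hc m hm]
      have hi := hext i 1 fun m hm => by simp [g, (hh m hm).1]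
      have hj := hext j 0 fun m hm => by simp [g, (hh m hm).2]
      rw [hij, hj] at hi
      exact zero_ne_one hi
  have h := congrArg (Φ.map (Function.extend v (x n) fun _ => Classical.arbitrary X)) hword
  rw [Φ.map_word, map_one] at h
  rwa [show Function.extend v (x n) (fun _ => Classical.arbitrary X) ∘ v = x n from
    funext fun j => hfac.extend_apply _ j] at h

theorem eventually_eq_one_of_tendsto [TopologicalSpace X] [T35Space X]
    (hX : SeparatesSequences X) {s : ℕ → Φ.obj X} (hs : Tendsto s atTop (𝓝 1)) :
    ∀ᶠ n in atTop, s n = 1 := by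
  by_contra hcon
  have hB : {n | s n ≠ 1}.Infinite := by
    rw [← Nat.frequently_atTop_iff_infinite]
    exact not_eventually.1 hcon
  rcases isEmpty_or_nonempty X with hX0 | hX0
  · obtain ⟨n, hn⟩ := hB.nonempty
    exact hn (Φ.eq_one_of_isEmpty _)
  have hinj := Φ.map_injective (isEmbedding_stoneCechUnit (X := X)).injective
  let σ : ℕ → Φ.obj (StoneCech X) := fun n => Φ.map stoneCechUnit (s n)
  have hσ : Tendsto σ atTop (𝓝 1) := by
    have h := ((Φ.continuous_map (continuous_stoneCechUnit (α := X))).tendsto 1).comp hs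
    rwa [map_one] at h
  -- The word length is bounded on an infinite set of indices.
  obtain ⟨l, hl⟩ : ∃ l : ℕ, {n ∈ {n | s n ≠ 1} | σ n ∈ Φ.letters (StoneCech X) ^ l}.Infinite := by
    by_contra! hfin
    have hnhds : (σ '' {n | s n ≠ 1})ᶜ ∈ 𝓝 (1 : Φ.obj (StoneCech X)) := by
      refine Φ.compl_mem_nhds_one ?_ fun l => ((hfin l).image σ).subset ?_
      · rintro ⟨n, hn, h1⟩
        exact hn (hinj (h1.trans (map_one _).symm))
      · rintro _ ⟨⟨n, hn, rfl⟩, hl⟩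
        exact ⟨n, ⟨hn, hl⟩, rfl⟩
    obtain ⟨n, hn, hn'⟩ :=
      ((Nat.frequently_atTop_iff_infinite.2 hB).and_eventually (hσ hnhds)).exists
    exact hn' ⟨n, hn, rfl⟩
  -- Collapsing the compactification set-theoretically, the letters may be taken in `X`.
  have hword : ∀ n, σ n ∈ Φ.letters (StoneCech X) ^ l →
      ∃ (x : Fin l → X) (e : Fin l → SignType), s n = Φ.word x e := by
    intro n hn
    have h := Φ.map_mem_letters_pow (Function.invFun (stoneCechUnit (α := X))) hn
    rw [Φ.map_map, Function.invFun_comp (isEmbedding_stoneCechUnit (X := X)).injective,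
      Φ.map_id] at h
    exact Φ.exists_word_of_mem_letters_pow h
  choose! x e hxe using hword
  obtain ⟨d, hd⟩ := hl.exists_infinite_fiber e
  obtain ⟨n, hn, h1⟩ := Φ.exists_word_eq_one hX x d hd (by
    refine (hσ.mono_left inf_le_left).congr' ?_
    filter_upwards [mem_inf_of_right (mem_principal_self _)] with n hn
    rw [← Φ.map_word, ← hn.2, ← hxe n hn.1.2])
  refine hn.1.1 ?_
  rw [hxe n hn.1.2, hn.2, h1]

end FreeGroupFunctor

/-! ### Separating sequences in the two classes of spaces -/

/-- A diagonal argument: if every infinite set of indices can be shrunk to an infinite one in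
relation `R` with any given index, then there is an infinite set in which every index is in relation
`R` with the set of the later ones. -/
theorem exists_infinite_forall_rel {R : ℕ → Set ℕ → Prop} {B : Set ℕ} (hB : B.Infinite)
    (hmono : ∀ n C D, C ⊆ D → R n D → R n C)
    (hR : ∀ n ∈ B, ∀ C ⊆ B, C.Infinite → ∃ D ⊆ C, D.Infinite ∧ R n D) :
    ∃ A ⊆ B, A.Infinite ∧ ∀ n ∈ A, R n (A ∩ Set.Ioi n) := by
  have step : ∀ C : {C : Set ℕ // C ⊆ B ∧ C.Infinite}, ∃ n ∈ C.1,
      ∃ D : {C : Set ℕ // C ⊆ B ∧ C.Infinite}, D.1 ⊆ C.1 ∩ Set.Ioi n ∧ R n D.1 := by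
    rintro ⟨C, hCB, hC⟩
    obtain ⟨n, hn⟩ := hC.nonempty
    have hC' : (C ∩ Set.Ioi n).Infinite := by
      have := hC.sdiff (Set.finite_Iic n)
      exact this.mono fun m hm => ⟨hm.1, Set.mem_Ioi.2 (not_le.1 fun h => hm.2 (Set.mem_Iic.2 h))⟩
    obtain ⟨D, hDC, hD, hRD⟩ := hR n (hCB hn) _ (Set.inter_subset_left.trans hCB) hC'
    exact ⟨n, hn, ⟨D, (hDC.trans Set.inter_subset_left).trans hCB, hD⟩, hDC, hRD⟩
  choose f hf D hD hRD using step
  let C : ℕ → {C : Set ℕ // C ⊆ B ∧ C.Infinite} := fun k => D^[k] ⟨B, subset_rfl, hB⟩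
  have hCsucc : ∀ k, C (k + 1) = D (C k) := fun k => Function.iterate_succ_apply' D k _
  have hCanti : Antitone fun k => (C k).1 := antitone_nat_of_succ_le fun k => by
    simp only [hCsucc]
    exact (hD (C k)).trans Set.inter_subset_left
  have hlt : ∀ j k, j < k → f (C k) ∈ (D (C j)).1 := fun j k hjk => by
    rw [← hCsucc]
    exact hCanti hjk (hf (C k))
  have hfmono : StrictMono fun k => f (C k) := fun j k hjk => (hD (C j) (hlt j k hjk)).2
  refine ⟨Set.range fun k => f (C k), ?_, Set.infinite_range_of_injective hfmono.injective, ?_⟩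
  · rintro _ ⟨k, rfl⟩
    exact (C k).2.1 (hf (C k))
  · rintro _ ⟨j, rfl⟩
    refine hmono _ _ _ ?_ (hRD (C j))
    rintro _ ⟨⟨k, rfl⟩, hk⟩
    exact hlt j k (hfmono.lt_iff_lt.1 hk)

/-- Every sequence can be thinned out so that a given point is not a limit point of it. -/
def CanAvoidPoints (X : Type*) [TopologicalSpace X] : Prop :=
  ∀ (y : ℕ → X) (w : X) (B : Set ℕ), B.Infinite → ∃ A ⊆ B, A.Infinite ∧ w ∉ closure (y '' A \ {w})

/-- Two sequences can be separated as soon as one of them is constant. -/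
theorem CanAvoidPoints.separate_const {X : Type*} [TopologicalSpace X] [T35Space X]
    (hX : CanAvoidPoints X) {y : ℕ → X} {w : X} {B : Set ℕ} (hB : B.Infinite)
    (hne : ∀ n ∈ B, y n ≠ w) :
    ∃ h : C(X, ℝ), ∃ A ⊆ B, A.Infinite ∧ ∀ n ∈ A, h (y n) = 1 ∧ h w = 0 := by
  obtain ⟨A, hAB, hA, hw⟩ := hX y w B hB
  obtain ⟨f, hf, hf0, hf1⟩ := CompletelyRegularSpace.completely_regular w _ isClosed_closure hw
  refine ⟨⟨fun x => f x, continuous_subtype_val.comp hf⟩, A, hAB, hA, fun n hn => ?_⟩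
  have := hf1 (subset_closure ⟨Set.mem_image_of_mem y hn, hne n (hAB hn)⟩)
  simp [this, hf0]

theorem exists_infinite_discrete {X : Type*} [TopologicalSpace X] [T2Space X] {S : Set X}
    (hS : S.Infinite) : ∃ E ⊆ S, E.Infinite ∧ DiscreteTopology E := by
  have := hS.to_subtype
  obtain ⟨f, hf⟩ := exists_topology_isEmbedding_nat S
  have hg : IsEmbedding fun n => (f n : X) := IsEmbedding.subtypeVal.comp hf
  refine ⟨Set.range fun n => (f n : X), ?_, Set.infinite_range_of_injective hg.injective, ?_⟩
  · rintro _ ⟨n, rfl⟩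
    exact (f n).2
  · exact hg.toHomeomorph.symm.isEmbedding.discreteTopology

theorem exists_infinite_eq_or_infinite_image {X : Type*} (y : ℕ → X) {B : Set ℕ}
    (hB : B.Infinite) : (∃ c, {n ∈ B | y n = c}.Infinite) ∨ (y '' B).Infinite := by
  by_contra! h
  have hfin : (y '' B).Finite := h.2
  refine hB ((hfin.biUnion fun c _ => h.1 c).subset fun n hn => ?_)
  exact Set.mem_biUnion (Set.mem_image_of_mem y hn) ⟨hn, rfl⟩

theorem IsCStarEmbedded.exists_indicator {X : Type*} [TopologicalSpace X] {D : Set X}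
    (hD : IsCStarEmbedded D) [DiscreteTopology D] (E : Set X) :
    ∃ h : C(X, ℝ), (∀ x ∈ D ∩ E, h x = 1) ∧ ∀ x ∈ D \ E, h x = 0 := by
  classical
  obtain ⟨g, hg⟩ := hD (BoundedContinuousFunction.ofNormedAddCommGroup
    (fun x : D => if (x : X) ∈ E then (1 : ℝ) else 0) continuous_of_discreteTopology 1
    (fun x => by split_ifs <;> simp))
  refine ⟨g.toContinuousMap, fun x hx => ?_, fun x hx => ?_⟩
  · simpa [hx.2] using hg ⟨x, hx.1⟩
  · simpa [hx.2] using hg ⟨x, hx.1⟩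

theorem Set.Infinite.exists_disjoint_infinite {α : Type*} {S : Set α} (hS : S.Infinite) :
    ∃ E ⊆ S, E.Infinite ∧ (S \ E).Infinite := by
  let f := hS.natEmbedding
  have hf : Function.Injective fun n => (f n : α) := Subtype.val_injective.comp f.injective
  refine ⟨Set.range fun n => (f (2 * n) : α), ?_, ?_, ?_⟩
  · rintro _ ⟨n, rfl⟩
    exact (f (2 * n)).2
  · exact Set.infinite_range_of_injective fun m n h => by
      have := hf h
      omega
  · refine (Set.infinite_range_of_injective (f := fun n => (f (2 * n + 1) : α)) fun m n h => by
      have := hf h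
      omega).mono ?_
    rintro _ ⟨n, rfl⟩
    refine ⟨(f (2 * n + 1)).2, ?_⟩
    rintro ⟨m, hm⟩
    have := hf hm
    omega

theorem notMem_closure_of_constant {X : Type*} [TopologicalSpace X] [T1Space X] {y : ℕ → X}
    {B : Set ℕ} (c w : X) : w ∉ closure (y '' {n ∈ B | y n = c} \ {w}) := by
  intro hw
  have hsub : y '' {n ∈ B | y n = c} ⊆ {c} := by
    rintro _ ⟨n, hn, rfl⟩
    exact hn.2
  have h1 := closure_mono (Set.sdiff_subset_sdiff_left hsub) hw
  rw [IsClosed.closure_eq ((Set.finite_singleton c).sdiff.isClosed)] at h1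
  exact h1.2 rfl

theorem canAvoidPoints_of_isCStarEmbedded {X : Type*} [TopologicalSpace X] [T2Space X]
    (hX : ∀ A : Set X, A.Countable → DiscreteTopology A → IsCStarEmbedded A) :
    CanAvoidPoints X := by
  intro y w B hB
  rcases exists_infinite_eq_or_infinite_image y hB with ⟨c, hc⟩ | hinf
  · exact ⟨_, Set.sep_subset _ _, hc, notMem_closure_of_constant c w⟩
  · obtain ⟨D, hDS, hD, hDd⟩ := exists_infinite_discrete hinf
    have hDc : D.Countable := (B.to_countable.image y).mono hDS
    obtain ⟨E, hED, hE, hDE⟩ := hD.exists_disjoint_infinite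
    obtain ⟨h, h1, h0⟩ := (hX D hDc hDd).exists_indicator E
    -- The values of `h` at limit points of `E` and of `D \ E` differ.
    have key : ∀ F ⊆ D, F.Infinite → w ∉ closure F → ∃ A ⊆ B, A.Infinite ∧
        w ∉ closure (y '' A \ {w}) := by
      intro F hFD hF hw
      refine ⟨B ∩ y ⁻¹' F, Set.inter_subset_left, ?_, fun hw' => hw (closure_mono ?_ hw')⟩
      · refine Set.Infinite.of_image y (hF.mono fun x hx => ?_)
        obtain ⟨n, hn, rfl⟩ := hDS (hFD hx)
        exact ⟨n, ⟨hn, hx⟩, rfl⟩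
      · rintro _ ⟨⟨n, hn, rfl⟩, -⟩
        exact hn.2
    by_cases hwE : w ∈ closure E
    · refine key (D \ E) Set.sdiff_subset hDE fun hwD => ?_
      have hv1 : h w = 1 := (isClosed_eq h.continuous continuous_const).closure_subset_iff.2
        (fun x hx => h1 x ⟨hED hx, hx⟩ : E ⊆ {x | h x = 1}) hwE
      have hv0 : h w = 0 := (isClosed_eq h.continuous continuous_const).closure_subset_iff.2
        (fun x hx => h0 x hx : D \ E ⊆ {x | h x = 0}) hwD
      exact one_ne_zero (hv1.symm.trans hv0)
    · exact key E hED hE hwE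

/-- Two finite-to-one sequences with distinct terms of equal index can be thinned out so that all
their terms together form a discrete set, in which the two ranges are disjoint. -/
theorem CanAvoidPoints.exists_discrete {X : Type*} [TopologicalSpace X] [T1Space X]
    (hX : CanAvoidPoints X) {a b : ℕ → X} {B : Set ℕ} (hB : B.Infinite)
    (hne : ∀ n ∈ B, a n ≠ b n) (ha : ∀ c, {n ∈ B | a n = c}.Finite)
    (hb : ∀ c, {n ∈ B | b n = c}.Finite) :
    ∃ A ⊆ B, A.Infinite ∧ DiscreteTopology (a '' A ∪ b '' A : Set X) ∧
      Disjoint (a '' A) (b '' A) := by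
  let Q : X → Set ℕ → Prop := fun w C =>
    w ∉ closure (a '' C \ {w}) ∧ w ∉ closure (b '' C \ {w})
  have hQmono : ∀ w C D, C ⊆ D → Q w D → Q w C := fun w C D hCD h =>
    ⟨fun h' => h.1 (closure_mono (Set.sdiff_subset_sdiff_left (Set.image_mono hCD)) h'),
      fun h' => h.2 (closure_mono (Set.sdiff_subset_sdiff_left (Set.image_mono hCD)) h')⟩
  have hQ : ∀ w (C : Set ℕ), C.Infinite → ∃ D ⊆ C, D.Infinite ∧ Q w D := by
    intro w C hC
    obtain ⟨D, hDC, hD, hDw⟩ := hX a w C hC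
    obtain ⟨E, hED, hE, hEw⟩ := hX b w D hD
    exact ⟨E, hED.trans hDC, hE, fun h' =>
      hDw (closure_mono (Set.sdiff_subset_sdiff_left (Set.image_mono hED)) h'), hEw⟩
  obtain ⟨A, hAB, hA, hR⟩ := exists_infinite_forall_rel
    (R := fun n C => (∀ m ∈ C, b m ≠ a n ∧ a m ≠ b n) ∧ Q (a n) C ∧ Q (b n) C) hB
    (fun n C D hCD h => ⟨fun m hm => h.1 m (hCD hm), hQmono _ _ _ hCD h.2.1,
      hQmono _ _ _ hCD h.2.2⟩)
    (by
      intro n hn C hCB hC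
      have hC' : (C \ ({m ∈ B | b m = a n} ∪ {m ∈ B | a m = b n})).Infinite :=
        hC.sdiff ((hb _).union (ha _))
      obtain ⟨D, hDC, hD, hDa⟩ := hQ (a n) _ hC'
      obtain ⟨E, hED, hE, hEb⟩ := hQ (b n) _ hD
      refine ⟨E, (hED.trans hDC).trans Set.sdiff_subset, hE, fun m hm => ?_,
        hQmono _ _ _ hED hDa, hEb⟩
      have hm' := hDC (hED hm)
      exact ⟨fun h => hm'.2 (Or.inl ⟨hCB hm'.1, h⟩), fun h => hm'.2 (Or.inr ⟨hCB hm'.1, h⟩)⟩)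
  refine ⟨A, hAB, hA, ?_, ?_⟩
  · have key : ∀ n ∈ A, ∀ w, Q w (A ∩ Set.Ioi n) →
        w ∉ closure ((a '' A ∪ b '' A) \ {w}) := by
      intro n hn w hw
      have hsub : (a '' A ∪ b '' A) \ {w} ⊆ (a '' Set.Iic n ∪ b '' Set.Iic n) \ {w} ∪
          (a '' (A ∩ Set.Ioi n) \ {w} ∪ b '' (A ∩ Set.Ioi n) \ {w}) := by
        rintro _ ⟨⟨m, hm, rfl⟩ | ⟨m, hm, rfl⟩, hmw⟩ <;> rcases le_or_gt m n with hmn | hmn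
        · exact Or.inl ⟨Or.inl ⟨m, hmn, rfl⟩, hmw⟩
        · exact Or.inr (Or.inl ⟨⟨m, ⟨hm, hmn⟩, rfl⟩, hmw⟩)
        · exact Or.inl ⟨Or.inr ⟨m, hmn, rfl⟩, hmw⟩
        · exact Or.inr (Or.inr ⟨⟨m, ⟨hm, hmn⟩, rfl⟩, hmw⟩)
      have hfin : ((a '' Set.Iic n ∪ b '' Set.Iic n) \ {w}).Finite :=
        (((Set.finite_Iic n).image a).union ((Set.finite_Iic n).image b)).sdiff
      intro h
      have h' := closure_mono hsub h
      rw [closure_union, closure_union, hfin.isClosed.closure_eq] at h'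
      rcases h' with h' | h' | h'
      · exact h'.2 rfl
      · exact hw.1 h'
      · exact hw.2 h'
    rw [discreteTopology_subtype_iff]
    intro w hw
    have hw' : w ∉ closure ((a '' A ∪ b '' A) \ {w}) := by
      rcases hw with ⟨n, hn, rfl⟩ | ⟨n, hn, rfl⟩
      · exact key n hn _ (hR n hn).2.1
      · exact key n hn _ (hR n hn).2.2
    rw [mem_closure_iff_clusterPt, ← accPt_principal_iff_clusterPt] at hw'
    exact not_neBot.1 hw'
  · rw [Set.disjoint_left]
    rintro _ ⟨n, hn, rfl⟩ ⟨m, hm, hmn⟩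
    rcases lt_trichotomy n m with h | h | h
    · exact ((hR n hn).1 m ⟨hm, h⟩).1 hmn
    · subst h
      exact hne n (hAB hn) hmn.symm
    · exact ((hR m hm).1 n ⟨hn, h⟩).2 hmn.symm

/-- Reduction of the separation of sequences to finite-to-one sequences whose ranges are disjoint
and form a discrete set. -/
theorem CanAvoidPoints.separatesSequences {X : Type*} [TopologicalSpace X] [T35Space X]
    (hX : CanAvoidPoints X)
    (hsep : ∀ (a b : ℕ → X) (B : Set ℕ), B.Infinite →
      (∀ c, {n ∈ B | a n = c}.Finite) → (∀ c, {n ∈ B | b n = c}.Finite) →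
      DiscreteTopology (a '' B ∪ b '' B : Set X) → Disjoint (a '' B) (b '' B) →
      ∃ h : C(X, ℝ), ∃ A ⊆ B, A.Infinite ∧ ∀ n ∈ A, h (a n) = 1 ∧ h (b n) = 0) :
    SeparatesSequences X := by
  intro a b B hB hne
  by_cases ha : ∃ c, {n ∈ B | a n = c}.Infinite
  · obtain ⟨c, hc⟩ := ha
    obtain ⟨h, A, hAB, hA, hh⟩ := hX.separate_const (y := b) (w := c) hc
      fun n hn h => hne n hn.1 (hn.2.trans h.symm)
    refine ⟨1 - h, A, hAB.trans (Set.sep_subset _ _), hA, fun n hn => ?_⟩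
    simp [(hAB hn).2, hh n hn]
  by_cases hb : ∃ c, {n ∈ B | b n = c}.Infinite
  · obtain ⟨c, hc⟩ := hb
    obtain ⟨h, A, hAB, hA, hh⟩ := hX.separate_const (y := a) (w := c) hc
      fun n hn h => hne n hn.1 (h.trans hn.2.symm)
    refine ⟨h, A, hAB.trans (Set.sep_subset _ _), hA, fun n hn => ?_⟩
    simp [(hAB hn).2, hh n hn]
  simp only [not_exists, Set.not_infinite] at ha hb
  obtain ⟨A, hAB, hA, hdisc, hdisj⟩ := hX.exists_discrete hB hne ha hb
  have hsub : ∀ (y : ℕ → X) c, {n ∈ A | y n = c} ⊆ {n ∈ B | y n = c} :=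
    fun y c n hn => ⟨hAB hn.1, hn.2⟩
  obtain ⟨h, A', hA'A, hA', hh⟩ := hsep a b A hA (fun c => (ha c).subset (hsub a c))
    (fun c => (hb c).subset (hsub b c)) hdisc hdisj
  exact ⟨h, A', hA'A.trans hAB, hA', hh⟩

theorem separatesSequences_of_isCStarEmbedded {X : Type*} [TopologicalSpace X] [T35Space X]
    (hX : ∀ A : Set X, A.Countable → DiscreteTopology A → IsCStarEmbedded A) :
    SeparatesSequences X := by
  refine (canAvoidPoints_of_isCStarEmbedded hX).separatesSequences
    fun a b B hB _ _ hdisc hdisj => ?_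
  obtain ⟨h, h1, h0⟩ := (hX _ ((B.to_countable.image a).union (B.to_countable.image b))
    hdisc).exists_indicator (a '' B)
  refine ⟨h, B, subset_rfl, hB, fun n hn => ⟨?_, ?_⟩⟩
  · exact h1 _ ⟨Or.inl (Set.mem_image_of_mem a hn), Set.mem_image_of_mem a hn⟩
  · have hbn := Set.mem_image_of_mem b hn
    exact h0 _ ⟨Or.inr hbn, Set.disjoint_right.1 hdisj hbn⟩

/-! ### Spaces whose functionally bounded sets are finite -/

/-- In a cf- and μ-space, each sequence of infinite range tends to infinity with respect to some
continuous function, along a subsequence. -/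
theorem exists_finite_le {X : Type*} [TopologicalSpace X] (hcf : IsCfSpace X) (hμ : IsMuSpace X)
    (y : ℕ → X) {B : Set ℕ} (hB : (y '' B).Infinite) :
    ∃ f : C(X, ℝ), (∀ x, 0 ≤ f x) ∧ ∃ A ⊆ B, A.Infinite ∧ ∀ M, {n ∈ A | f (y n) ≤ M}.Finite := by
  obtain ⟨g, hg⟩ : ∃ g : C(X, ℝ), ¬ Bornology.IsBounded (g '' (y '' B)) := by
    by_contra! h
    exact hB ((hcf _ (hμ _ h)).subset subset_closure)
  have hn : ∀ k : ℕ, ∃ n ∈ B, (k : ℝ) < |g (y n)| := by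
    by_contra! h
    obtain ⟨k, hk⟩ := h
    refine hg (isBounded_iff_forall_norm_le.2 ⟨k, ?_⟩)
    rintro _ ⟨_, ⟨n, hn, rfl⟩, rfl⟩
    exact hk n hn
  choose n hnB hn using hn
  have hfin : ∀ M, {m ∈ Set.range n | |g (y m)| ≤ M}.Finite := by
    intro M
    refine ((Set.finite_Iio ⌈M⌉₊).image n).subset ?_
    rintro _ ⟨⟨k, rfl⟩, hk⟩
    refine ⟨k, ?_, rfl⟩
    exact_mod_cast ((hn k).trans_le hk).trans_le (Nat.le_ceil M)
  refine ⟨⟨fun x => |g x|, by fun_prop⟩, fun x => abs_nonneg _, Set.range n,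
    Set.range_subset_iff.2 hnB, fun h => ?_, hfin⟩
  obtain ⟨M, hM⟩ := (h.image fun m => |g (y m)|).bddAbove
  obtain ⟨k, hk⟩ := exists_nat_gt M
  have := hM ⟨n k, ⟨k, rfl⟩, rfl⟩
  have := hn k
  dsimp only at *
  linarith

theorem canAvoidPoints_of_isCfSpace {X : Type*} [TopologicalSpace X] [T1Space X]
    (hcf : IsCfSpace X) (hμ : IsMuSpace X) : CanAvoidPoints X := by
  intro y w B hB
  rcases exists_infinite_eq_or_infinite_image y hB with ⟨c, hc⟩ | hinf
  · exact ⟨_, Set.sep_subset _ _, hc, notMem_closure_of_constant c w⟩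
  obtain ⟨f, -, A, hAB, hA, hf⟩ := exists_finite_le hcf hμ y hinf
  refine ⟨A \ {n ∈ A | f (y n) ≤ f w + 1}, Set.sdiff_subset.trans hAB, hA.sdiff (hf _),
    fun hw => ?_⟩
  have hsub : y '' (A \ {n ∈ A | f (y n) ≤ f w + 1}) \ {w} ⊆ {x | f w + 1 ≤ f x} := by
    rintro _ ⟨⟨n, hn, rfl⟩, -⟩
    exact le_of_not_ge fun h => hn.2 ⟨hn.1, h⟩
  have := (isClosed_le continuous_const f.continuous).closure_subset_iff.2 hsub hw
  simp only [Set.mem_ofPred_eq] at this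
  linarith

/-- Indicator functions on a set along which a continuous function `f` tends to infinity extend.
The extensions are sums of bumps, which are locally finite because of `f`. -/
theorem exists_indicator_of_finite_le {X : Type*} [TopologicalSpace X] [T35Space X] {D : Set X}
    (f : C(X, ℝ)) (hf : ∀ M, {x ∈ D | f x ≤ M}.Finite) (E : Set X) :
    ∃ h : C(X, ℝ), (∀ x ∈ D ∩ E, h x = 1) ∧ ∀ x ∈ D \ E, h x = 0 := by
  have hbump : ∀ d : X, ∃ g : X → ℝ, Continuous g ∧ g d = 1 ∧
      (∀ x, 1 ≤ |f x - f d| → g x = 0) ∧ ∀ x ∈ D, x ≠ d → g x = 0 := by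
    intro d
    obtain ⟨k, hk, hk0, hk1⟩ := CompletelyRegularSpace.completely_regular d
      ({x ∈ D | f x ≤ f d + 1} \ {d}) (hf _).sdiff.isClosed (fun h => h.2 rfl)
    have hfar : ∀ x, 1 ≤ |f x - f d| → (1 - (k x : ℝ)) * max 0 (1 - |f x - f d|) = 0 := by
      intro x hx
      rw [max_eq_left (by linarith), mul_zero]
    refine ⟨fun x => (1 - (k x : ℝ)) * max 0 (1 - |f x - f d|), by fun_prop, by simp [hk0], hfar,
      fun x hx hxd => ?_⟩
    by_cases hxf : f x ≤ f d + 1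
    · have : k x = 1 := hk1 ⟨⟨hx, hxf⟩, hxd⟩
      simp [this]
    · exact hfar x ((by linarith : 1 ≤ f x - f d).trans (le_abs_self _))
  choose g hg hgd hgfar hgD using hbump
  have hloc : LocallyFinite fun d : (D ∩ E : Set X) => Function.support (g d) := by
    intro x
    refine ⟨{z | f z < f x + 1}, (isOpen_lt f.continuous continuous_const).mem_nhds (by simp), ?_⟩
    refine Set.Finite.of_finite_image (f := Subtype.val) ((hf (f x + 2)).subset ?_)
      Subtype.val_injective.injOn
    rintro _ ⟨d, ⟨z, hz, hzx⟩, rfl⟩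
    refine ⟨d.2.1, ?_⟩
    have h1 : |f z - f d| < 1 := not_le.1 fun h => hz (hgfar d z h)
    have h2 := (abs_lt.1 h1).1
    simp only [Set.mem_ofPred_eq] at hzx
    linarith
  refine ⟨⟨fun x => ∑ᶠ d : (D ∩ E : Set X), g d x, continuous_finsum (fun d => hg d) hloc⟩,
    fun x hx => ?_, fun x hx => ?_⟩
  · change ∑ᶠ d : (D ∩ E : Set X), g d x = 1
    rw [finsum_eq_single (fun d : (D ∩ E : Set X) => g d x) ⟨x, hx⟩ fun d hd =>
      hgD d x hx.1 fun h => hd (Subtype.ext h.symm)]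
    exact hgd x
  · change ∑ᶠ d : (D ∩ E : Set X), g d x = 0
    refine finsum_eq_zero_of_forall_eq_zero fun d => hgD d x hx.1 fun h => hx.2 (h ▸ d.2.2)

theorem separatesSequences_of_isCfSpace {X : Type*} [TopologicalSpace X] [T35Space X]
    (hcf : IsCfSpace X) (hμ : IsMuSpace X) : SeparatesSequences X := by
  refine (canAvoidPoints_of_isCfSpace hcf hμ).separatesSequences
    fun a b B hB ha hb _ hdisj => ?_
  have himage : ∀ (y : ℕ → X) (C : Set ℕ), C.Infinite → (∀ c, {n ∈ C | y n = c}.Finite) →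
      (y '' C).Infinite := fun y C hC hy =>
    (exists_infinite_eq_or_infinite_image y hC).resolve_left (by simpa using hy)
  obtain ⟨f, hf0, A, hAB, hA, hf⟩ := exists_finite_le hcf hμ a (himage a B hB ha)
  obtain ⟨g, hg0, A', hA'A, hA', hg⟩ := exists_finite_le hcf hμ b
    (himage b A hA fun c => (hb c).subset fun n hn => ⟨hAB hn.1, hn.2⟩)
  obtain ⟨h, h1, h0⟩ := exists_indicator_of_finite_le (D := a '' A' ∪ b '' A') (f + g) (by
    intro M
    refine (((hf M).image a).union ((hg M).image b)).subset ?_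
    rintro _ ⟨⟨n, hn, rfl⟩ | ⟨n, hn, rfl⟩, hM⟩ <;> simp only [ContinuousMap.add_apply] at hM
    · exact Or.inl ⟨n, ⟨hA'A hn, by linarith [hg0 (a n)]⟩, rfl⟩
    · exact Or.inr ⟨n, ⟨hn, by linarith [hf0 (b n)]⟩, rfl⟩) (a '' B)
  refine ⟨h, A', hA'A.trans hAB, hA', fun n hn => ⟨?_, ?_⟩⟩
  · exact h1 _ ⟨Or.inl ⟨n, hn, rfl⟩, n, hAB (hA'A hn), rfl⟩
  · exact h0 _ ⟨Or.inr ⟨n, hn, rfl⟩, Set.disjoint_right.1 hdisj ⟨n, hAB (hA'A hn), rfl⟩⟩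

/-! ### The Stone–Čech compactification of a discrete space -/

/-- The points of a countable discrete subset of a regular space have pairwise disjoint open
neighborhoods. -/
theorem exists_disjoint_open_nhds {X : Type*} [TopologicalSpace X] [RegularSpace X] {A : Set X}
    (hA : A.Countable) [DiscreteTopology A] :
    ∃ W : A → Set X, (∀ a, IsOpen (W a) ∧ (a : X) ∈ W a) ∧
      Pairwise (Function.onFun Disjoint W) := by
  have hC : ∀ a : A, ∃ C ∈ 𝓝 (a : X), IsClosed C ∧ ∀ b : A, (b : X) ∈ C → b = a := by
    intro a
    obtain ⟨O, hO, hOa⟩ := isOpen_induced_iff.1 (isOpen_discrete ({a} : Set A))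
    have haO : (a : X) ∈ O := by
      have : a ∈ (Subtype.val ⁻¹' O : Set A) := hOa ▸ rfl
      exact this
    obtain ⟨C, hC, hCc, hCO⟩ := exists_mem_nhds_isClosed_subset (hO.mem_nhds haO)
    refine ⟨C, hC, hCc, fun b hb => ?_⟩
    have : b ∈ (Subtype.val ⁻¹' O : Set A) := hCO hb
    rwa [hOa] at this
  choose C hCa hCc hC using hC
  have := hA.to_subtype
  obtain ⟨e, he⟩ := exists_injective_nat A
  have hfin : ∀ a, {b | e b < e a}.Finite := fun a => (Set.finite_Iio (e a)).preimage he.injOn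
  refine ⟨fun a => interior (C a) \ ⋃ b ∈ {b | e b < e a}, C b, fun a => ⟨?_, ?_, ?_⟩, ?_⟩
  · exact isOpen_interior.sdiff ((hfin a).isClosed_biUnion fun b _ => hCc b)
  · exact mem_interior_iff_mem_nhds.2 (hCa a)
  · intro h
    obtain ⟨b, hb, hab⟩ := Set.mem_iUnion₂.1 h
    have hba : e b < e a := hb
    rw [hC b a hab] at hba
    exact lt_irrefl _ hba
  · have key : ∀ a b, e a < e b → Disjoint (interior (C a) \ ⋃ c ∈ {c | e c < e a}, C c)
        (interior (C b) \ ⋃ c ∈ {c | e c < e b}, C c) := by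
      intro a b hab
      refine Set.disjoint_left.2 fun x hxa hxb => hxb.2 ?_
      exact Set.mem_iUnion₂.2 ⟨a, hab, interior_subset hxa.1⟩
    intro a b hab
    rcases lt_or_gt_of_ne (he.ne hab) with h | h
    · exact key a b h
    · exact (key b a h).symm

/-- A bounded function on a countable discrete subset of `βD` spreads to disjoint neighborhoods of
its points; restricted to `D`, it extends to `βD`. -/
theorem isCStarEmbedded_stoneCech {D : Type*} [TopologicalSpace D] [DiscreteTopology D]
    {A : Set (StoneCech D)} (hA : A.Countable) (hd : DiscreteTopology A) : IsCStarEmbedded A := by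
  classical
  intro f
  obtain ⟨W, hW, hdisj⟩ := exists_disjoint_open_nhds hA
  let F : D → ℝ := fun d => if h : ∃ a, stoneCechUnit d ∈ W a then f h.choose else 0
  have hF : ∀ d, F d ∈ Set.Icc (-‖f‖) ‖f‖ := by
    intro d
    simp only [F]
    split_ifs with h
    · exact abs_le.1 (f.norm_coe_le_norm h.choose)
    · simp
  have hFW : ∀ a d, stoneCechUnit d ∈ W a → F d = f a := by
    intro a d had
    have h : ∃ a, stoneCechUnit d ∈ W a := ⟨a, had⟩
    have : h.choose = a := by
      by_contra hne
      exact Set.disjoint_left.1 (hdisj hne) h.choose_spec had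
    simp only [F, dif_pos h, this]
  have hc : Continuous fun d => (⟨F d, hF d⟩ : Set.Icc (-‖f‖) ‖f‖) := continuous_of_discreteTopology
  let G : C(StoneCech D, ℝ) :=
    ⟨fun x => (stoneCechExtend hc x : Set.Icc (-‖f‖) ‖f‖),
      continuous_subtype_val.comp (continuous_stoneCechExtend hc)⟩
  refine ⟨BoundedContinuousFunction.mkOfCompact G, fun a => ?_⟩
  have hsub : W a ∩ Set.range stoneCechUnit ⊆ {x | G x = f a} := by
    rintro _ ⟨had, d, rfl⟩
    change ((stoneCechExtend hc (stoneCechUnit d) : Set.Icc (-‖f‖) ‖f‖) : ℝ) = f a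
    rw [stoneCechExtend_stoneCechUnit]
    exact hFW a d had
  have hdense : Dense (Set.range (stoneCechUnit : D → StoneCech D)) := denseRange_stoneCechUnit
  exact (isClosed_eq G.continuous continuous_const).closure_subset_iff.2 hsub
    (hdense.open_subset_closure_inter (hW a).1 (hW a).2)

/-! ### Countability of sequential neighborhoods -/

theorem snfCountable_of_eventually_eq {G : Type*} [TopologicalSpace G]
    (h : ∀ (s : ℕ → G) (a : G), Tendsto s atTop (𝓝 a) → ∀ᶠ n in atTop, s n = a) :
    SnfCountable G := by
  refine ⟨fun a => {{a}}, ⟨?_, ?_, ?_⟩, fun a => Set.countable_singleton _⟩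
  · rintro a _ rfl _ rfl
    exact ⟨{a}, rfl, by simp⟩
  · intro a U _ ha
    exact ⟨{a}, rfl, rfl, Set.singleton_subset_iff.2 ha⟩
  · rintro a _ rfl s hs
    exact h s a hs

/-- The free group on a set, as a functor. -/
def freeGroupFunctor : FreeGroupFunctor.{u} where
  obj := FreeGroup
  of := FreeGroup.of
  map := FreeGroup.map
  map_of := fun _ _ => FreeGroup.map.of
  closure_range_of := FreeGroup.closure_range_of

/-- The free Abelian group on a set, as a functor, in multiplicative notation. -/
def freeAbelianGroupFunctor : FreeGroupFunctor.{u} where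
  obj X := Multiplicative (FreeAbelianGroup X)
  of x := Multiplicative.ofAdd (FreeAbelianGroup.of x)
  map f := AddMonoidHom.toMultiplicative (FreeAbelianGroup.map f)
  map_of f x := by simp
  closure_range_of X := by
    refine (Subgroup.eq_top_iff' _).2 fun a => ?_
    induction a using Multiplicative.rec with | _ a => ?_
    induction a using FreeAbelianGroup.induction_on with
    | zero => exact Subgroup.one_mem _
    | of x => exact Subgroup.subset_closure ⟨x, rfl⟩
    | neg x h => exact Subgroup.inv_mem _ h
    | add a b ha hb => exact Subgroup.mul_mem _ ha hb

theorem FreeTopologicalGroup.snfCountable {X : Type u} [TopologicalSpace X] [T35Space X]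
    (hX : SeparatesSequences X) : SnfCountable (FreeTopologicalGroup X) := by
  refine snfCountable_of_eventually_eq fun s a hs => ?_
  have hs' : Tendsto (fun n => a⁻¹ * s n) atTop (𝓝 1) := by
    simpa using hs.const_mul a⁻¹
  filter_upwards [freeGroupFunctor.eventually_eq_one_of_tendsto hX hs'] with n hn
  exact (inv_mul_eq_one.1 hn).symm

/-- The identity map, from `A(X)` to its multiplicative copy. -/
def FreeAbelianTopologicalGroup.toMul {X : Type u} [TopologicalSpace X]
    (a : FreeAbelianTopologicalGroup X) : freeAbelianGroupFunctor.obj X :=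
  Multiplicative.ofAdd (α := FreeAbelianGroup X) a

/-- The topology of `A(X)` is finer than the one given by the multiplicative free group functor. -/
theorem FreeAbelianTopologicalGroup.continuous_toMul (X : Type u) [TopologicalSpace X] :
    Continuous (toMul : FreeAbelianTopologicalGroup X → freeAbelianGroupFunctor.obj X) := by
  let τ : TopologicalSpace (freeAbelianGroupFunctor.obj X) := inferInstance
  let t : AddGroupTopology (FreeAbelianTopologicalGroup X) :=
    { toTopologicalSpace := τ
      continuous_add := (continuous_mul :
        Continuous fun p : freeAbelianGroupFunctor.obj X × freeAbelianGroupFunctor.obj X =>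
          p.1 * p.2)
      continuous_neg := (continuous_inv :
        Continuous fun a : freeAbelianGroupFunctor.obj X => a⁻¹) }
  have ht : AddGroupTopology.coinduced (of X) ≤ t :=
    sInf_le (continuous_iff_coinduced_le.1 freeAbelianGroupFunctor.continuous_of)
  have ht' : (AddGroupTopology.coinduced (of X)).toTopologicalSpace ≤ t.toTopologicalSpace := ht
  exact continuous_def.2 fun U hU => ht' U hU

theorem FreeAbelianTopologicalGroup.snfCountable {X : Type u} [TopologicalSpace X] [T35Space X]
    (hX : SeparatesSequences X) : SnfCountable (FreeAbelianTopologicalGroup X) := by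
  refine snfCountable_of_eventually_eq fun s a hs => ?_
  have hs' : Tendsto (fun n => -a + s n) atTop (𝓝 0) := by
    simpa using hs.const_add (-a)
  have h : Tendsto (fun n => toMul (-a + s n)) atTop (𝓝 1) :=
    ((continuous_toMul X).tendsto 0).comp hs'
  filter_upwards [freeAbelianGroupFunctor.eventually_eq_one_of_tendsto hX h] with n hn
  have hn' : -a + s n = 0 := hn
  exact (neg_add_eq_zero.1 hn').symm

theorem theorem3p2 :
    (∀ (X : Type u) [TopologicalSpace X] [T35Space X],
      ((IsCfSpace X ∧ IsMuSpace X) ∨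
        (∀ A : Set X, A.Countable → DiscreteTopology A → IsCStarEmbedded A)) →
      SnfCountable (FreeTopologicalGroup X) ∧ SnfCountable (FreeAbelianTopologicalGroup X)) ∧
    (∀ (D : Type v) [TopologicalSpace D] [DiscreteTopology D],
      SnfCountable (FreeTopologicalGroup (StoneCech D)) ∧
        SnfCountable (FreeAbelianTopologicalGroup (StoneCech D))) := by
  refine ⟨fun X _ _ hX => ?_, fun D _ _ => ?_⟩
  · have hsep : SeparatesSequences X :=
      hX.elim (fun h => separatesSequences_of_isCfSpace h.1 h.2)
        separatesSequences_of_isCStarEmbedded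
    exact ⟨FreeTopologicalGroup.snfCountable hsep, FreeAbelianTopologicalGroup.snfCountable hsep⟩
  · have hsep : SeparatesSequences (StoneCech D) :=
      separatesSequences_of_isCStarEmbedded fun A hA hd => isCStarEmbedded_stoneCech hA hd
    exact ⟨FreeTopologicalGroup.snfCountable hsep, FreeAbelianTopologicalGroup.snfCountable hsep⟩
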